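/- For a non-negative integer $n$ let $$A_n=\sum_{k=0}^n\binom{n}{k}^2\binom{n+k}{k}^2\quad\text{and}\quad A'_n=\sum_{k=0}^n\binom{n}{k}^2\binom{n+k}{k}$$ be the Apéry numbers, and let $B_n$ be the Bernoulli numbers, defined by $\frac{x}{e^x-1}=\sum_{n=0}^{\infty}B_n\frac{x^n}{n!}$. For a prime $p$ and rational numbers $a,b$, write $a\equiv b\pmod{p^4}$ if $a-b=p^4c$ for a rational number $c$ whose reduced denominator is not divisible by $p$. Then for every prime $p\ge 5$, $$A_{p-1}\equiv 1+\frac{2}{3}p^3B_{p-3}\pmod{p^4}\quad\text{and}\quad A'_{p-1}\equiv 1+\frac{5}{3}p^3B_{p-3}\pmod{p^4}.$$ -/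

import Mathlib

/-- The Apéry numbers `A_n = ∑_{k=0}^n C(n,k)^2 C(n+k,k)^2` (related to `ζ(3)`). -/
def aperyA (n : ℕ) : ℕ :=
  ∑ k ∈ Finset.range (n + 1), n.choose k ^ 2 * (n + k).choose k ^ 2

/-- The Apéry numbers `A'_n = ∑_{k=0}^n C(n,k)^2 C(n+k,k)` (related to `ζ(2)`). -/
def aperyA' (n : ℕ) : ℕ :=
  ∑ k ∈ Finset.range (n + 1), n.choose k ^ 2 * (n + k).choose k

/-- Congruence of rational numbers modulo `m`: the difference `a - b` is `m` times a rational
number whose reduced denominator is coprime to `m`. For `m = p ^ r` with `r ≥ 1` this says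
`a - b ∈ p ^ r ℤ_(p)`. -/
def RatModEq (m : ℕ) (a b : ℚ) : Prop :=
  ∃ c : ℚ, c.den.Coprime m ∧ a - b = (m : ℚ) * c

/-! Put `n = p - 1`, `P = p` and `x_j = 1/(j+1)` in the ring of `p`-integral rationals. Then
`C(n,k)` is `(-1)^k ∏_{j≤k} (1 - p/j)` and `C(n+k,k)` is `(p/k) ∏_{j<k} (1 + p/j)`, so both Apéry
sums expand in powers of `P` with symmetric sums of the `x_j` as coefficients. Write `s_a = ∑ 1/j^a`
and `T = ∑_{i<j} 1/(i j^2)`. The reflection `j ↦ p - j` ties `s_1` to `s_2` and gives `P ∣ s_3`. The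
identity `∑ (-1)^k C(n,k)/k = -s_1` supplies a second relation, and together they yield `3 s_2 ≡ 2 P
T` mod `P^2` (`exists_apery_sums`). Both sums thus reduce to multiples of `P^3 T`, and `T ≡ B_{p-3}`
mod `p` by Fermat and Faulhaber (`dvd_doubleSum_sub_bernoulli`). -/

open Finset

/-! ### Symmetric sums and truncated expansions in `P` -/

section TruncatedSums

variable {R : Type*} [CommRing R]

/-- The power sum `∑_{j<n} x_j ^ a`. -/
def powerSum (x : ℕ → R) (a n : ℕ) : R := ∑ j ∈ range n, x j ^ a

/-- The second elementary symmetric function of `x_0, …, x_{n-1}`. -/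
def elemTwo (x : ℕ → R) (n : ℕ) : R := ∑ j ∈ range n, x j * powerSum x 1 j

/-- The third elementary symmetric function of `x_0, …, x_{n-1}`. -/
def elemThree (x : ℕ → R) (n : ℕ) : R := ∑ j ∈ range n, x j * elemTwo x j

/-- The double sum `∑_{i<j<n} x_i x_j ^ 2`. -/
def doubleSum (x : ℕ → R) (n : ℕ) : R := ∑ j ∈ range n, x j ^ 2 * powerSum x 1 j

theorem powerSum_succ (x : ℕ → R) (a n : ℕ) :
    powerSum x a (n + 1) = powerSum x a n + x n ^ a := sum_range_succ _ _

theorem elemTwo_succ (x : ℕ → R) (n : ℕ) :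
    elemTwo x (n + 1) = elemTwo x n + x n * powerSum x 1 n := sum_range_succ _ _

theorem elemThree_succ (x : ℕ → R) (n : ℕ) :
    elemThree x (n + 1) = elemThree x n + x n * elemTwo x n := sum_range_succ _ _

theorem doubleSum_succ (x : ℕ → R) (n : ℕ) :
    doubleSum x (n + 1) = doubleSum x n + x n ^ 2 * powerSum x 1 n := sum_range_succ _ _

theorem two_mul_elemTwo (x : ℕ → R) (n : ℕ) :
    2 * elemTwo x n = powerSum x 1 n ^ 2 - powerSum x 2 n := by
  induction n with
  | zero => simp [elemTwo, powerSum]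
  | succ n ih => rw [elemTwo_succ, powerSum_succ, powerSum_succ]; linear_combination ih

theorem six_mul_elemThree (x : ℕ → R) (n : ℕ) :
    6 * elemThree x n =
      powerSum x 1 n ^ 3 - 3 * powerSum x 1 n * powerSum x 2 n + 2 * powerSum x 3 n := by
  induction n with
  | zero => simp [elemThree, powerSum]
  | succ n ih =>
    rw [elemThree_succ, powerSum_succ, powerSum_succ, powerSum_succ]
    linear_combination ih + 3 * x n * two_mul_elemTwo x n

/-- Split `s_1 s_2` according to which of the two indices is larger, or whether they agree. -/
theorem sum_mul_powerSum_two (x : ℕ → R) (n : ℕ) :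
    ∑ j ∈ range n, x j * powerSum x 2 j =
      powerSum x 1 n * powerSum x 2 n - powerSum x 3 n - doubleSum x n := by
  induction n with
  | zero => simp [doubleSum, powerSum]
  | succ n ih =>
    rw [sum_range_succ, ih, doubleSum_succ, powerSum_succ, powerSum_succ, powerSum_succ]
    ring

theorem exists_prod_one_sub_mul (P : R) (x : ℕ → R) (n : ℕ) :
    ∃ c, ∏ j ∈ range n, (1 - P * x j) =
      1 - P * powerSum x 1 n + P ^ 2 * elemTwo x n + P ^ 3 * c := by
  induction n with
  | zero => exact ⟨0, by simp [elemTwo, powerSum]⟩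
  | succ n ih =>
    obtain ⟨c, hc⟩ := ih
    refine ⟨c * (1 - P * x n) - x n * elemTwo x n, ?_⟩
    rw [prod_range_succ, hc, elemTwo_succ, powerSum_succ]
    ring

theorem exists_prod_one_sub_sq (P : R) (x : ℕ → R) (n : ℕ) :
    ∃ c, ∏ j ∈ range n, (1 - P ^ 2 * x j ^ 2) = 1 - P ^ 2 * powerSum x 2 n + P ^ 3 * c := by
  induction n with
  | zero => exact ⟨0, by simp [powerSum]⟩
  | succ n ih =>
    obtain ⟨c, hc⟩ := ih
    refine ⟨c * (1 - P ^ 2 * x n ^ 2) + P * powerSum x 2 n * x n ^ 2, ?_⟩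
    rw [prod_range_succ, hc, powerSum_succ]
    ring

/-- The sum of the terms of the first Apéry sum, modulo the fourth power. -/
theorem exists_sum_sq_terms (P : R) (x : ℕ → R) (n : ℕ) :
    ∃ c, ∑ m ∈ range n, (P * x m * (1 - P * x m) * ∏ j ∈ range m, (1 - P ^ 2 * x j ^ 2)) ^ 2 =
      P ^ 2 * powerSum x 2 n - 2 * P ^ 3 * powerSum x 3 n + P ^ 4 * c := by
  induction n with
  | zero => exact ⟨0, by simp [powerSum]⟩
  | succ n ih =>
    obtain ⟨c, hc⟩ := ih
    obtain ⟨d, hd⟩ := exists_prod_one_sub_sq P x n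
    obtain ⟨s, hs⟩ : ∃ s, s = -powerSum x 2 n + P * d := ⟨_, rfl⟩
    have hd' : ∏ j ∈ range n, (1 - P ^ 2 * x j ^ 2) = 1 + P ^ 2 * s := by
      rw [hd, hs]; ring
    refine ⟨c + x n ^ 4 + x n ^ 2 * (1 - P * x n) ^ 2 * (2 * s + P ^ 2 * s ^ 2), ?_⟩
    rw [sum_range_succ, hc, hd', powerSum_succ, powerSum_succ]
    ring

/-- The sum of the terms of the second Apéry sum, modulo the fourth power. -/
theorem exists_sum_mixed_terms (P : R) (x : ℕ → R) (n : ℕ) :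
    ∃ c, ∑ m ∈ range n, P * x m * (1 - P * x m) ^ 2 *
        ((∏ j ∈ range m, (1 - P ^ 2 * x j ^ 2)) * ∏ j ∈ range m, (1 - P * x j)) =
      P * powerSum x 1 n - P ^ 2 * (2 * powerSum x 2 n + elemTwo x n) +
        P ^ 3 * (powerSum x 3 n + 2 * doubleSum x n + elemThree x n -
          ∑ j ∈ range n, x j * powerSum x 2 j) + P ^ 4 * c := by
  induction n with
  | zero => exact ⟨0, by simp [powerSum, elemTwo, elemThree, doubleSum]⟩
  | succ n ih =>
    obtain ⟨c, hc⟩ := ih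
    obtain ⟨d, hd⟩ := exists_prod_one_sub_sq P x n
    obtain ⟨e, he⟩ := exists_prod_one_sub_mul P x n
    have key : ∃ f, (∏ j ∈ range n, (1 - P ^ 2 * x j ^ 2)) * ∏ j ∈ range n, (1 - P * x j) =
        1 - P * powerSum x 1 n + P ^ 2 * (elemTwo x n - powerSum x 2 n) + P ^ 3 * f := by
      refine ⟨d * (1 - P * powerSum x 1 n + P ^ 2 * elemTwo x n + P ^ 3 * e) +
        (1 - P ^ 2 * powerSum x 2 n) * e + powerSum x 2 n * (powerSum x 1 n - P * elemTwo x n), ?_⟩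
      rw [hd, he]; ring
    obtain ⟨f, hf⟩ := key
    refine ⟨c + x n * ((1 - P * x n) ^ 2 * f - x n ^ 2 * powerSum x 1 n +
      (-2 * x n + P * x n ^ 2) * (elemTwo x n - powerSum x 2 n)), ?_⟩
    rw [sum_range_succ, hc, hf, powerSum_succ, powerSum_succ, powerSum_succ, elemTwo_succ,
      elemThree_succ, doubleSum_succ, sum_range_succ]
    ring

/-- For `x_j = 1/(j+1)` and `P = n + 1` the left side is `∑ (-1)^k C(n,k)/k`, whose exact value
gives the second relation between `s_1` and `s_2`. -/
theorem exists_sum_mul_prod (P : R) (x : ℕ → R) (n : ℕ) :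
    ∃ c, ∑ m ∈ range n, x m * ∏ j ∈ range (m + 1), (1 - P * x j) =
      powerSum x 1 n - P * (powerSum x 2 n + elemTwo x n) +
        P ^ 2 * (doubleSum x n + elemThree x n) + P ^ 3 * c := by
  induction n with
  | zero => exact ⟨0, by simp [powerSum, elemTwo, elemThree, doubleSum]⟩
  | succ n ih =>
    obtain ⟨c, hc⟩ := ih
    obtain ⟨e, he⟩ := exists_prod_one_sub_mul P x (n + 1)
    refine ⟨c + x n * e, ?_⟩
    rw [sum_range_succ, hc, he, powerSum_succ, powerSum_succ, elemTwo_succ,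
      elemThree_succ, doubleSum_succ]
    ring

/-- Consequences of the reflection `y = -x + P x y`. -/
theorem exists_powerSum_of_reflection {P : R} {x : ℕ → R} {n : ℕ}
    (h : ∀ j < n, x (n - 1 - j) = -x j + P * x j * x (n - 1 - j)) :
    (∃ c, 2 * powerSum x 1 n = -P * powerSum x 2 n - P ^ 2 * powerSum x 3 n + P ^ 3 * c) ∧
      ∃ c, 2 * powerSum x 3 n = P * c := by
  constructor
  · refine ⟨∑ j ∈ range n, x j ^ 3 * x (n - 1 - j), ?_⟩
    have h1 : powerSum x 1 n = ∑ j ∈ range n, x (n - 1 - j) ^ 1 :=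
      (sum_range_reflect (fun j => x j ^ 1) n).symm
    rw [two_mul]
    nth_rw 1 [h1]
    simp only [powerSum, mul_sum, ← sum_add_distrib, ← sum_sub_distrib]
    refine sum_congr rfl fun j hj => ?_
    have := h j (mem_range.1 hj)
    -- Geometric series: `y (1 - P x) = -x` gives `y = -x - P x^2 - P^2 x^3 + P^3 x^3 y`.
    linear_combination (1 + P * x j + P ^ 2 * x j ^ 2) * this
  · refine ⟨∑ j ∈ range n, x j * x (n - 1 - j) *
      (x j ^ 2 - x j * x (n - 1 - j) + x (n - 1 - j) ^ 2), ?_⟩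
    have h1 : powerSum x 3 n = ∑ j ∈ range n, x (n - 1 - j) ^ 3 :=
      (sum_range_reflect (fun j => x j ^ 3) n).symm
    rw [two_mul]
    nth_rw 1 [h1]
    simp only [powerSum, mul_sum, ← sum_add_distrib]
    refine sum_congr rfl fun j hj => ?_
    have := h j (mem_range.1 hj)
    -- `x + y = P x y` divides `x^3 + y^3`.
    linear_combination (x j ^ 2 - x j * x (n - 1 - j) + x (n - 1 - j) ^ 2) * this

/-- The two Apéry-type sums modulo the fourth power, in terms of the double sum. -/
theorem exists_apery_sums [IsDomain R] {P : R} (hP : P ≠ 0) {x : ℕ → R} {n : ℕ} {a b B : R}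
    (ha : 2 * a = 1) (hb : 3 * b = 1)
    (hrefl : ∀ j < n, x (n - 1 - j) = -x j + P * x j * x (n - 1 - j))
    (hharm : ∑ m ∈ range n, x m * ∏ j ∈ range (m + 1), (1 - P * x j) = -powerSum x 1 n)
    (hT : P ∣ doubleSum x n - B) :
    (∃ c, ∑ m ∈ range n,
        (P * x m * (1 - P * x m) * ∏ j ∈ range m, (1 - P ^ 2 * x j ^ 2)) ^ 2 =
      2 * b * P ^ 3 * B + P ^ 4 * c) ∧
    ∃ c, ∑ m ∈ range n, P * x m * (1 - P * x m) ^ 2 *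
        ((∏ j ∈ range m, (1 - P ^ 2 * x j ^ 2)) * ∏ j ∈ range m, (1 - P * x j)) =
      5 * b * P ^ 3 * B + P ^ 4 * c := by
  obtain ⟨⟨c₁, h₁⟩, c₃, h₃⟩ := exists_powerSum_of_reflection hrefl
  obtain ⟨c₂, h₂⟩ := exists_sum_mul_prod P x n
  obtain ⟨c₄, h₄⟩ := exists_sum_sq_terms P x n
  obtain ⟨c₅, h₅⟩ := exists_sum_mixed_terms P x n
  obtain ⟨t, hT⟩ := hT
  rw [hharm] at h₂
  rw [sum_mul_powerSum_two] at h₅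
  have he2 := two_mul_elemTwo x n
  have he3 := six_mul_elemThree x n
  generalize powerSum x 1 n = s₁ at *
  generalize powerSum x 2 n = s₂ at *
  generalize powerSum x 3 n = s₃ at *
  generalize elemTwo x n = e₂ at *
  generalize elemThree x n = e₃ at *
  generalize doubleSum x n = T at *
  obtain ⟨u₃, hu₃⟩ : ∃ u, s₃ = P * u := ⟨a * c₃, by linear_combination a * h₃ - s₃ * ha⟩
  obtain ⟨u₁, hu₁⟩ : ∃ u, s₁ = P * u :=
    ⟨a * (-s₂ - P * s₃ + P ^ 2 * c₁), by linear_combination a * h₁ - s₁ * ha⟩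
  obtain ⟨v, hv⟩ : ∃ v, e₃ = P * v :=
    ⟨a * b * (u₁ * s₁ ^ 2 - 3 * u₁ * s₂ + 2 * u₃), by
      linear_combination a * b * he3 - e₃ * ha - 2 * a * e₃ * hb +
        a * b * (s₁ ^ 2 - 3 * s₂) * hu₁ + 2 * a * b * hu₃⟩
  -- Eliminating `s₁` leaves a relation divisible by `P`; cancelling it costs one power, hence the
  -- precision `P ^ 3` in `h₁` and `h₂`.
  obtain ⟨w, hw⟩ : ∃ w, 3 * s₂ = 2 * P * T + P ^ 2 * w := by
    refine ⟨2 * v - 2 * u₃ + 2 * c₁ - u₁ ^ 2 + 2 * c₂, mul_left_cancel₀ hP ?_⟩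
    linear_combination 2 * h₁ + 2 * h₂ - P * he2 + 2 * P ^ 2 * hv - 2 * P ^ 2 * hu₃ -
      P * (s₁ + P * u₁) * hu₁
  constructor
  · refine ⟨c₄ + b * w + 2 * b * t - 2 * u₃, ?_⟩
    rw [h₄]
    linear_combination b * P ^ 2 * hw - P ^ 2 * s₂ * hb - 2 * P ^ 3 * hu₃ + 2 * b * P ^ 3 * hT
  · rw [h₅]
    generalize hX : P * s₁ - P ^ 2 * (2 * s₂ + e₂) +
      P ^ 3 * (s₃ + 2 * T + e₃ - (s₁ * s₂ - s₃ - T)) + P ^ 4 * c₅ = X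
    -- Modulo `P ^ 4`, the first two terms of `X` give `-2 P^2 s₂ = -(4/3) P^3 T` and the third
    -- gives `3 P^3 T`.
    obtain ⟨z, hz⟩ : ∃ z, 6 * X = 10 * P ^ 3 * B + P ^ 4 * z := by
      refine ⟨9 * u₃ + 3 * c₁ - 3 * u₁ ^ 2 - 4 * w + 6 * v - 6 * u₁ * s₂ + 6 * c₅ + 10 * t, ?_⟩
      rw [← hX]
      linear_combination 3 * P * h₁ - 3 * P ^ 2 * he2 - 4 * P ^ 2 * hw + 9 * P ^ 3 * hu₃ +
        6 * P ^ 3 * hv + 10 * P ^ 3 * hT - 3 * P ^ 2 * (s₁ + P * u₁) * hu₁ - 6 * P ^ 3 * s₂ * hu₁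
    exact ⟨a * b * z, by
      linear_combination a * b * hz - X * ha - 2 * a * X * hb + 5 * b * P ^ 3 * B * ha⟩

end TruncatedSums

/-! ### Rationals integral at `p`, and power sums modulo `p` -/

/-- The ring of rational numbers whose denominator is prime to `p`. -/
def coprimeDenSubring (p : ℕ) : Subring ℚ where
  carrier := {q | q.den.Coprime p}
  mul_mem' {a b} ha hb := (Nat.Coprime.mul_left ha hb).of_dvd_left (Rat.mul_den_dvd a b)
  one_mem' := by simp
  add_mem' {a b} ha hb := (Nat.Coprime.mul_left ha hb).of_dvd_left (Rat.add_den_dvd a b)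
  zero_mem' := by simp
  neg_mem' {a} ha := by simpa using ha

theorem mem_coprimeDenSubring {p : ℕ} {q : ℚ} : q ∈ coprimeDenSubring p ↔ q.den.Coprime p :=
  Iff.rfl

@[simp, norm_cast]
theorem coe_ofNat_coprimeDenSubring (p n : ℕ) [n.AtLeastTwo] :
    ((ofNat(n) : coprimeDenSubring p) : ℚ) = ofNat(n) := rfl

theorem inv_natCast_mem_coprimeDenSubring {p k : ℕ} (hp : p.Prime) (hk : 0 < k) (hkp : k < p) :
    (k : ℚ)⁻¹ ∈ coprimeDenSubring p := by
  rw [mem_coprimeDenSubring, Rat.inv_natCast_den_of_pos hk]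
  exact (Nat.coprime_of_lt_prime hk.ne' hkp hp).symm

/-- Bernoulli numbers of index at most `p - 2` are `p`-integral. -/
theorem bernoulli_mem_coprimeDenSubring {p : ℕ} (hp : p.Prime) (r : ℕ) (hr : r + 1 < p) :
    bernoulli r ∈ coprimeDenSubring p := by
  induction r using Nat.strong_induction_on with
  | _ r ih =>
    have h := sum_bernoulli (r + 1)
    rw [sum_range_succ, Nat.choose_succ_self_right] at h
    have h' : bernoulli r = ((r + 1 : ℕ) : ℚ)⁻¹ * ((if r + 1 = 1 then 1 else 0) -
        ∑ k ∈ range r, ((r + 1).choose k : ℚ) * bernoulli k) := by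
      rw [← h]; field_simp; ring
    rw [h']
    refine mul_mem (inv_natCast_mem_coprimeDenSubring hp r.succ_pos hr) (sub_mem ?_ ?_)
    · split_ifs
      exacts [one_mem _, zero_mem _]
    · exact sum_mem fun k hk => mul_mem (natCast_mem _ _)
        (ih k (mem_range.1 hk) (by have := mem_range.1 hk; omega))

theorem prime_dvd_sum_range_pow {p i : ℕ} (hp : p.Prime) (hi : i < p - 1) :
    p ∣ ∑ k ∈ range p, k ^ i := by
  have : Fact p.Prime := ⟨hp⟩
  rw [← ZMod.natCast_eq_zero_iff]
  push_cast
  have h := FiniteField.sum_pow_lt_card_sub_one (ZMod p) i (by rwa [ZMod.card])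
  rw [← h]
  refine sum_bij (fun k _ => (k : ZMod p)) (by simp) ?_ ?_ (by simp)
  · intro a ha b hb hab
    have := (ZMod.natCast_eq_natCast_iff' a b p).1 hab
    rwa [Nat.mod_eq_of_lt (mem_range.1 ha), Nat.mod_eq_of_lt (mem_range.1 hb)] at this
  · intro b _
    exact ⟨b.val, mem_range.2 b.val_lt, by simp⟩

theorem prime_dvd_pow_sub_one {p k : ℕ} (hp : p.Prime) (hk : 0 < k) (hkp : k < p) :
    (p : ℤ) ∣ (k : ℤ) ^ (p - 1) - 1 := by
  have := Int.ModEq.pow_card_sub_one_eq_one hp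
    (Nat.isCoprime_iff_coprime.2 (Nat.coprime_of_lt_prime hk.ne' hkp hp).symm)
  exact this.symm.dvd

/-! ### Binomial identities -/

/-- The alternating sum of `C(n, k) / k` over `1 ≤ k ≤ n` is the `n`-th harmonic number. -/
theorem sum_neg_one_pow_mul_choose_div (n : ℕ) :
    ∑ m ∈ range n, (-1 : ℚ) ^ m * n.choose (m + 1) / (m + 1) = ∑ m ∈ range n, 1 / ((m : ℚ) + 1) := by
  induction n with
  | zero => simp
  | succ n ih =>
    -- By Pascal's rule this is the increment from `n` to `n + 1`; it follows from `(1 - 1)^(n+1) =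
    -- 0`.
    have h1 : ∑ m ∈ range (n + 1), (-1 : ℚ) ^ m * n.choose m / (m + 1) = 1 / ((n : ℚ) + 1) := by
      have h2 : ∀ m ∈ range (n + 1), (-1 : ℚ) ^ m * n.choose m / (m + 1) =
          -((-1 : ℚ) ^ (m + 1) * (n + 1).choose (m + 1)) / (n + 1) := by
        intro m _
        have h3 : ((n : ℚ) + 1) * n.choose m = (n + 1).choose (m + 1) * (m + 1) := by
          exact_mod_cast Nat.add_one_mul_choose_eq n m
        field_simp
        linear_combination (-1 : ℚ) ^ m * h3
      rw [sum_congr rfl h2, ← sum_div, sum_neg_distrib]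
      have h4 := Int.alternating_sum_range_choose_of_ne (n := n + 1) (by omega)
      rw [sum_range_succ'] at h4
      have h5 : ∑ m ∈ range (n + 1), (-1 : ℚ) ^ (m + 1) * (n + 1).choose (m + 1) + 1 = 0 := by
        exact_mod_cast (by simpa using h4 : _ = (0 : ℤ))
      rw [eq_neg_of_add_eq_zero_left h5]
      simp
    rw [sum_range_succ (fun m => 1 / ((m : ℚ) + 1)), ← ih, ← h1]
    have h6 : ∑ m ∈ range n, (-1 : ℚ) ^ m * n.choose (m + 1) / (m + 1) =
        ∑ m ∈ range (n + 1), (-1 : ℚ) ^ m * n.choose (m + 1) / (m + 1) := by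
      rw [sum_range_succ]; simp
    rw [h6, ← sum_add_distrib]
    refine sum_congr rfl fun m _ => ?_
    rw [Nat.choose_succ_succ]
    push_cast
    ring

/-- The product `∏_{1≤j≤k} (1 - (n + 1) / j)` equals `(-1) ^ k C(n, k)`. -/
theorem prod_one_sub_div (n k : ℕ) (hk : k ≤ n) :
    ∏ j ∈ range k, (1 - ((n : ℚ) + 1) * ((j : ℚ) + 1)⁻¹) = (-1) ^ k * n.choose k := by
  induction k with
  | zero => simp
  | succ k ih =>
    rw [prod_range_succ, ih (by omega)]
    have h : (n.choose (k + 1) : ℚ) * (k + 1) = n.choose k * (n - k) := by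
      have := Nat.choose_succ_right_eq n k
      rw [← Nat.cast_sub (by omega)]
      exact_mod_cast this
    field_simp
    linear_combination (-1 : ℚ) ^ k * h

theorem prod_one_add_div (n k : ℕ) :
    ((n : ℚ) + 1) * ((k : ℚ) + 1)⁻¹ * ∏ j ∈ range k, (1 + ((n : ℚ) + 1) * ((j : ℚ) + 1)⁻¹) =
      (n + (k + 1)).choose (k + 1) := by
  induction k with
  | zero => simp
  | succ k ih =>
    have h : ((n : ℚ) + (k + 1) + 1) * (n + (k + 1)).choose (k + 1) =
        (n + (k + 1 + 1)).choose (k + 1 + 1) * (k + 1 + 1) := by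
      exact_mod_cast Nat.add_one_mul_choose_eq (n + (k + 1)) (k + 1)
    rw [← ih] at h
    rw [prod_range_succ]
    push_cast
    field_simp at h ⊢
    linear_combination h

/-! ### The double sum and the Bernoulli number -/

/-- The summand `0 ^ i` is the `k = 0` term; it is nonzero only for `i = 0`, where the sum over
nonzero residues is `-1` rather than `0`. -/
theorem dvd_sum_succ_pow {p i : ℕ} (hp : p.Prime) (hi : i < p - 1) (R : Type*) [CommRing R] :
    (p : R) ∣ ∑ m ∈ range (p - 1), ((m : R) + 1) ^ i + 0 ^ i := by
  obtain ⟨c, hc⟩ := prime_dvd_sum_range_pow hp hi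
  obtain ⟨n, rfl⟩ : ∃ n, p = n + 1 := ⟨p - 1, by omega⟩
  rw [sum_range_succ'] at hc
  refine ⟨(c : R), ?_⟩
  rw [Nat.add_sub_cancel]
  exact_mod_cast congrArg (Nat.cast (R := R)) hc

/-- The double sum `∑_{i<j<p} 1 / (i j ^ 2)` is congruent to `B_{p-3}` modulo `p`. -/
theorem dvd_doubleSum_sub_bernoulli {q : ℕ} (hp : (q + 3).Prime) (hq : 2 ≤ q)
    {x : ℕ → coprimeDenSubring (q + 3)}
    (hx : ∀ j < q + 2, (x j : ℚ) = ((j : ℚ) + 1)⁻¹)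
    {B : coprimeDenSubring (q + 3)} (hB : (B : ℚ) = bernoulli q) :
    ((q + 3 : ℕ) : coprimeDenSubring (q + 3)) ∣ doubleSum x (q + 2) - B := by
  have hxk : ∀ m < q + 2, x m * ((m : coprimeDenSubring (q + 3)) + 1) = 1 := by
    intro m hm
    apply Subtype.ext
    push_cast
    rw [hx m hm]
    field_simp
  have hb : ∃ b : ℕ → coprimeDenSubring (q + 3), ∀ r < q + 2, (b r : ℚ) = bernoulli r := by
    refine ⟨fun r => if h : r < q + 2 then
      ⟨bernoulli r, bernoulli_mem_coprimeDenSubring hp r (by omega)⟩ else 0, fun r hr => ?_⟩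
    simp [hr]
  obtain ⟨b, hb⟩ := hb
  have hbq : b q = B := Subtype.ext (by rw [hb q (by omega), hB])
  have hodd : b (q + 1) = 0 := by
    apply Subtype.ext
    rw [hb _ (by omega)]
    refine bernoulli_eq_zero_of_odd ?_ (by omega)
    have := hp.odd_of_ne_two (by omega)
    grind
  -- Faulhaber's formula; since `B_{q+1} = 0`, every exponent is at least `2` and can absorb the
  -- factor `1/j^2`.
  have hfaul : ∀ n : ℕ, ((q : coprimeDenSubring (q + 3)) + 2) *
      ∑ k ∈ range n, (k : coprimeDenSubring (q + 3)) ^ (q + 1) =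
      ∑ i ∈ range (q + 1), b i * ((q + 2).choose i : coprimeDenSubring (q + 3)) *
        (n : coprimeDenSubring (q + 3)) ^ (q - i + 2) := by
    intro n
    have h1 : ∑ i ∈ range (q + 1), b i * ((q + 2).choose i : coprimeDenSubring (q + 3)) *
        (n : coprimeDenSubring (q + 3)) ^ (q - i + 2) =
        ∑ i ∈ range (q + 2), b i * ((q + 2).choose i : coprimeDenSubring (q + 3)) *
        (n : coprimeDenSubring (q + 3)) ^ (q + 2 - i) := by
      rw [sum_range_succ _ (q + 1), hodd]
      simp only [zero_mul, add_zero]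
      refine sum_congr rfl fun i hi => ?_
      rw [show q + 2 - i = q - i + 2 by have := mem_range.1 hi; omega]
    rw [h1]
    apply Subtype.ext
    push_cast
    rw [sum_range_pow, mul_sum]
    refine sum_congr rfl fun i hi => ?_
    rw [hb i (mem_range.1 hi)]
    push_cast
    field_simp
    ring
  have hinv : ∀ m < q + 2, ((q + 3 : ℕ) : coprimeDenSubring (q + 3)) ∣
      -- Fermat: `1/k ≡ k^(p-2)`.
      powerSum x 1 m - ∑ k ∈ range (m + 1), (k : coprimeDenSubring (q + 3)) ^ (q + 1) := by
    intro m hm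
    rw [sum_range_succ', powerSum]
    simp only [Nat.cast_zero, ne_eq, Nat.add_eq_zero_iff, one_ne_zero, and_false,
      not_false_eq_true, zero_pow, add_zero, ← sum_sub_distrib]
    refine dvd_sum fun j hj => ?_
    have hj' : j < q + 2 := by have := mem_range.1 hj; omega
    obtain ⟨c, hc⟩ := prime_dvd_pow_sub_one hp j.succ_pos (by omega : j + 1 < q + 3)
    have hc' := congrArg (Int.cast (R := coprimeDenSubring (q + 3))) hc
    rw [show q + 3 - 1 = q + 1 + 1 by omega] at hc'
    push_cast at hc' ⊢
    refine ⟨-(x j * c), ?_⟩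
    linear_combination (-x j) * hc' + ((j : coprimeDenSubring (q + 3)) + 1) ^ (q + 1) * hxk j hj'
  have hT : ((q + 3 : ℕ) : coprimeDenSubring (q + 3)) ∣
      ((q : coprimeDenSubring (q + 3)) + 2) * doubleSum x (q + 2) -
      ∑ i ∈ range (q + 1), b i * ((q + 2).choose i : coprimeDenSubring (q + 3)) *
        ∑ m ∈ range (q + 2), ((m : coprimeDenSubring (q + 3)) + 1) ^ (q - i) := by
    simp only [doubleSum, mul_sum]
    rw [sum_comm, ← sum_sub_distrib]
    refine dvd_sum fun m hm => ?_
    have hm' := mem_range.1 hm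
    obtain ⟨c, hc⟩ := hinv m hm'
    refine ⟨((q : coprimeDenSubring (q + 3)) + 2) * x m ^ 2 * c, ?_⟩
    have h2 : ∑ i ∈ range (q + 1), b i * ((q + 2).choose i : coprimeDenSubring (q + 3)) *
        ((m : coprimeDenSubring (q + 3)) + 1) ^ (q - i) =
        x m ^ 2 * ∑ i ∈ range (q + 1), b i * ((q + 2).choose i : coprimeDenSubring (q + 3)) *
        ((m + 1 : ℕ) : coprimeDenSubring (q + 3)) ^ (q - i + 2) := by
      rw [mul_sum]
      refine sum_congr rfl fun i _ => ?_
      push_cast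
      linear_combination (-b i * ((q + 2).choose i : coprimeDenSubring (q + 3)) *
        ((m : coprimeDenSubring (q + 3)) + 1) ^ (q - i)) *
        (x m * ((m : coprimeDenSubring (q + 3)) + 1) + 1) * hxk m hm'
    rw [h2, ← hfaul]
    linear_combination ((q : coprimeDenSubring (q + 3)) + 2) * x m ^ 2 * hc
  have hS : ((q + 3 : ℕ) : coprimeDenSubring (q + 3)) ∣
      ∑ i ∈ range (q + 1), b i * ((q + 2).choose i : coprimeDenSubring (q + 3)) *
        ∑ m ∈ range (q + 2), ((m : coprimeDenSubring (q + 3)) + 1) ^ (q - i) +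
      B * ((q + 2).choose q : coprimeDenSubring (q + 3)) := by
    -- Only the index `i = q`, with exponent `0`, survives modulo `p`.
    have h3 : B * ((q + 2).choose q : coprimeDenSubring (q + 3)) =
        ∑ i ∈ range (q + 1), b i * ((q + 2).choose i : coprimeDenSubring (q + 3)) *
          0 ^ (q - i) := by
      rw [sum_range_succ, sum_eq_zero, hbq]
      · simp
      · intro i hi
        have := mem_range.1 hi
        rw [zero_pow (by omega), mul_zero]
    rw [h3, ← sum_add_distrib]
    refine dvd_sum fun i hi => ?_
    rw [← mul_add]
    exact (dvd_sum_succ_pow hp (by omega) _).mul_left _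
  have hchoose : 2 * ((q + 2).choose q : coprimeDenSubring (q + 3)) = (q + 2) * (q + 1) := by
    have h4 : 2 * (q + 2).choose q = (q + 2) * (q + 1) := by
      have := Nat.choose_symm_add (a := q) (b := 2)
      rw [this, Nat.choose_two_right]
      exact Nat.mul_div_cancel' (Nat.even_mul_pred_self (q + 2)).two_dvd
    exact_mod_cast congrArg (Nat.cast (R := coprimeDenSubring (q + 3))) h4
  obtain ⟨c, hc⟩ := hT
  obtain ⟨d, hd⟩ := hS
  have h2 := hxk 1 (by omega)
  push_cast at hc hd h2 ⊢
  -- Here `x 1 = 1/2`, `2(q+2) = 2p - 2` and `(q+2)(q+1) = qp + 2`.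
  refine ⟨-x 1 * (2 * c + 2 * d - 2 * doubleSum x (q + 2) - q * B), ?_⟩
  linear_combination (-2 * x 1) * hc - 2 * x 1 * hd + x 1 * B * hchoose +
    (B - doubleSum x (q + 2)) * h2

/-! ### Apéry numbers as truncated sums, and conclusion -/

theorem aperyA_eq_one_add (n : ℕ) : (aperyA n : ℚ) =
    1 + ∑ m ∈ range n, ((n.choose (m + 1) : ℚ) * (n + (m + 1)).choose (m + 1)) ^ 2 := by
  simp [aperyA, sum_range_succ', mul_pow, add_comm]

theorem aperyA'_eq_one_add (n : ℕ) : (aperyA' n : ℚ) =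
    1 + ∑ m ∈ range n, (n.choose (m + 1) : ℚ) ^ 2 * (n + (m + 1)).choose (m + 1) := by
  simp [aperyA', sum_range_succ', add_comm]

theorem prod_one_sub_sq_eq_mul {R : Type*} [CommRing R] (P : R) (x : ℕ → R) (m : ℕ) :
    ∏ j ∈ range m, (1 - P ^ 2 * x j ^ 2) =
      (∏ j ∈ range m, (1 - P * x j)) * ∏ j ∈ range m, (1 + P * x j) := by
  rw [← prod_mul_distrib]
  exact prod_congr rfl fun j _ => by ring

theorem RatModEq.of_eq_add {p r : ℕ} {a b : ℚ} (c : coprimeDenSubring p)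
    (h : a = b + (p : ℚ) ^ r * c) : RatModEq (p ^ r) a b :=
  ⟨c, Nat.Coprime.pow_right r c.2, by rw [h]; push_cast; ring⟩

theorem mainTheorem3 (p : ℕ) (hp : p.Prime) (hp5 : 5 ≤ p) :
    RatModEq (p ^ 4) (aperyA (p - 1) : ℚ) (1 + (2 / 3 : ℚ) * (p : ℚ) ^ 3 * bernoulli (p - 3)) ∧
    RatModEq (p ^ 4) (aperyA' (p - 1) : ℚ)
      (1 + (5 / 3 : ℚ) * (p : ℚ) ^ 3 * bernoulli (p - 3)) := by
  obtain ⟨q, rfl⟩ : ∃ q, p = q + 3 := ⟨p - 3, by omega⟩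
  rw [show q + 3 - 1 = q + 2 by omega, show q + 3 - 3 = q by omega]
  obtain ⟨x, hx⟩ : ∃ x : ℕ → coprimeDenSubring (q + 3),
      ∀ j < q + 2, (x j : ℚ) = ((j : ℚ) + 1)⁻¹ := by
    -- The cutoff is needed because `1/(q+3)` is not `p`-integral; all sums stay below it.
    refine ⟨fun j => if h : j < q + 2 then
      ⟨((j + 1 : ℕ) : ℚ)⁻¹, inv_natCast_mem_coprimeDenSubring hp j.succ_pos (by omega)⟩ else 0,
      fun j hj => ?_⟩
    simp [hj]
  let B : coprimeDenSubring (q + 3) :=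
    ⟨bernoulli q, bernoulli_mem_coprimeDenSubring hp q (by omega)⟩
  have hprod : ∀ m < q + 2, ∏ j ∈ range (m + 1), (1 - ((q : ℚ) + 3) * x j) =
      (-1) ^ (m + 1) * (q + 2).choose (m + 1) := by
    intro m hm
    rw [← prod_one_sub_div _ _ (by omega)]
    refine prod_congr rfl fun j hj => ?_
    rw [hx j (by have := mem_range.1 hj; omega)]
    push_cast
    ring
  have hprod' : ∀ m < q + 2, ((q : ℚ) + 3) * x m * ∏ j ∈ range m, (1 + ((q : ℚ) + 3) * x j) =
      (q + 2 + (m + 1)).choose (m + 1) := by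
    intro m hm
    rw [← prod_one_add_div, hx m hm]
    push_cast
    rw [show (q : ℚ) + 2 + 1 = q + 3 by ring]
    congr 1
    refine prod_congr rfl fun j hj => ?_
    rw [hx j (by have := mem_range.1 hj; omega)]
  -- `C(n,k)` enters both Apéry sums squared, so its sign drops out.
  have hone : ∀ m : ℕ, ((-1 : ℚ) ^ m) ^ 2 = 1 := fun m => by rw [← pow_mul, mul_comm]; simp
  have hP : ((q + 3 : ℕ) : coprimeDenSubring (q + 3)) ≠ 0 := by
    intro h
    have := congrArg Subtype.val h
    push_cast at this
    have h' : (0 : ℚ) < q + 3 := by positivity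
    exact h'.ne' this
  have htwo : 2 * x 1 = 1 := by
    apply Subtype.ext
    push_cast
    rw [hx 1 (by omega)]
    norm_num
  have hthree : 3 * x 2 = 1 := by
    apply Subtype.ext
    push_cast
    rw [hx 2 (by omega)]
    norm_num
  have hrefl : ∀ j < q + 2, x (q + 2 - 1 - j) =
      -x j + ((q + 3 : ℕ) : coprimeDenSubring (q + 3)) * x j * x (q + 2 - 1 - j) := by
    intro j hj
    apply Subtype.ext
    push_cast
    rw [hx j hj, hx (q + 1 - j) (by omega),
      Nat.cast_sub (by omega)]
    have : (q : ℚ) + 1 - j + 1 ≠ 0 := by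
      have : (j : ℚ) < q + 2 := by exact_mod_cast hj
      intro h
      linarith
    push_cast
    field_simp
    ring
  have hharm : ∑ m ∈ range (q + 2), x m *
      ∏ j ∈ range (m + 1), (1 - ((q + 3 : ℕ) : coprimeDenSubring (q + 3)) * x j) =
      -powerSum x 1 (q + 2) := by
    apply Subtype.ext
    simp only [powerSum, pow_one]
    push_cast
    have h : ∑ m ∈ range (q + 2), (x m : ℚ) = ∑ m ∈ range (q + 2), 1 / ((m : ℚ) + 1) :=
      sum_congr rfl fun m hm => by rw [hx m (mem_range.1 hm), one_div]
    rw [h, ← sum_neg_one_pow_mul_choose_div, ← sum_neg_distrib]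
    refine sum_congr rfl fun m hm => ?_
    rw [hprod m (mem_range.1 hm), hx m (mem_range.1 hm)]
    field_simp
    ring
  have hB : (B : ℚ) = bernoulli q := rfl
  obtain ⟨⟨c, hc⟩, d, hd⟩ := exists_apery_sums hP htwo hthree hrefl hharm
    (dvd_doubleSum_sub_bernoulli hp (by omega) hx hB)
  have hx2 : (x 2 : ℚ) = 1 / 3 := by rw [hx 2 (by omega)]; norm_num
  constructor
  · refine RatModEq.of_eq_add c ?_
    have h := congrArg Subtype.val hc
    push_cast at h
    rw [hx2, hB] at h
    rw [aperyA_eq_one_add, add_assoc]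
    congr 1
    push_cast
    convert h using 1
    · refine sum_congr rfl fun m hm => ?_
      have hm := mem_range.1 hm
      have h1 := hprod m hm
      rw [prod_range_succ] at h1
      have h2 := hone (m + 1)
      rw [prod_one_sub_sq_eq_mul, ← hprod' m hm]
      generalize ∏ j ∈ range m, (1 + ((q : ℚ) + 3) * x j) = U at *
      generalize ∏ j ∈ range m, (1 - ((q : ℚ) + 3) * x j) = V at *
      generalize ((q : ℚ) + 3) * x m = y at *
      generalize (-1 : ℚ) ^ (m + 1) = e at *
      generalize ((q + 2).choose (m + 1) : ℚ) = C at *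
      linear_combination (-(y * U) ^ 2 * C ^ 2) * h2 - (y * U) ^ 2 * (V * (1 - y) + e * C) * h1
    · ring
  · refine RatModEq.of_eq_add d ?_
    have h := congrArg Subtype.val hd
    push_cast at h
    rw [hx2, hB] at h
    rw [aperyA'_eq_one_add, add_assoc]
    congr 1
    push_cast
    convert h using 1
    · refine sum_congr rfl fun m hm => ?_
      have hm := mem_range.1 hm
      have h1 := hprod m hm
      rw [prod_range_succ] at h1
      have h2 := hone (m + 1)
      rw [prod_one_sub_sq_eq_mul, ← hprod' m hm]
      generalize ∏ j ∈ range m, (1 + ((q : ℚ) + 3) * x j) = U at *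
      generalize ∏ j ∈ range m, (1 - ((q : ℚ) + 3) * x j) = V at *
      generalize ((q : ℚ) + 3) * x m = y at *
      generalize (-1 : ℚ) ^ (m + 1) = e at *
      generalize ((q + 2).choose (m + 1) : ℚ) = C at *
      linear_combination (-(y * U) * C ^ 2) * h2 - (y * U) * (V * (1 - y) + e * C) * h1
    · ring
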